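/- **Theorem (second-order sufficient conditions).** Let $\Omega\subset\mathbb{R}^d$, $d\ge 1$, be a bounded domain, $\nu>0$, $y_d\in L^2(\Omega)$, $u_d\in L^\infty(\Omega)$, and write $(\cdot,\cdot)$ for the $L^2(\Omega)$ scalar product, $\langle\cdot,\cdot\rangle$ for the pairing of $H^{-1}(\Omega)$ and $H^1_0(\Omega)$ (with $L^2(\Omega)\subset H^{-1}(\Omega)$ via $(\cdot,\cdot)$), and $a(y,v)=(\nabla y,\nabla v)$. For $u\in H^{-1}(\Omega)$ let $S(u)=y\in H^1_0(\Omega)$ be the unique solution of $$a(y,v-y)+\|v\|_{L^1(\Omega)}-\|y\|_{L^1(\Omega)}\ge\langle u,v-y\rangle\quad\forall v\in H^1_0(\Omega),$$ and let $Q(u)=q\in L^\infty(\Omega)\subset H^{-1}(\Omega)$ be the slack variable, i.e. the unique $q$ with $a(y,v)+(q,v)=\langle u,v\rangle$ for all $v\in H^1_0(\Omega)$ and $q\,y=|y|$, $|q|\le 1$ a.e. in $\Omega$. For $u\in L^2(\Omega)$ put $f(u)=\tfrac12\|S(u)-y_d\|_{L^2(\Omega)}^2+\tfrac{\nu}{2}\|u-u_d\|_{L^2(\Omega)}^2$.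 Let $\bar u\in L^2(\Omega)$, $\bar y=S(\bar u)$, $\bar q=Q(\bar u)$, and assume: 1. (Regularity) $\bar y\in C^1(\Omega)$. 2. (Structure of the active set) There is a closed set $\mathcal{C}\subseteq\Gamma:=\partial\{\bar y\ne0\}\cup\partial\Omega$ of $H^1(\mathbb{R}^d)$-capacity zero such that $\Gamma\setminus\mathcal{C}$ is a strong $(d-1)$-dimensional Lipschitz submanifold of $\mathbb{R}^d$ (locally the graph of a Lipschitz function of $d-1$ variables) and the sets $\mathcal{N}_+=(\{\nabla\bar y=0\}\cap\partial\{\bar y>0\})\setminus\mathcal{C}$ and $\mathcal{N}_-=(\{\nabla\bar y=0\}\cap\partial\{\bar y<0\})\setminus\mathcal{C}$ are relatively open in $\Gamma\setminus\mathcal{C}$. 3. The set $\mathcal{M}=\{x\in\Omega:\bar y(x)=0,\ \nabla\bar y(x)\ne0\}$ is empty. 4. (Strong stationarity) $\bar p\in H^1_0(\Omega)$ and $\bar\mu\in H^{-1}(\Omega)$ satisfy $$\bar p+\nu(\bar u-u_d)=0\ \text{ a.e. in }\Omega,\qquad a(\bar p,v)=(\bar y-y_d,v)-\langle\bar\mu,v\rangle\quad\forall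 v\in H^1_0(\Omega),$$ $$\bar p\in\mathcal{K}(\bar y),\qquad\langle\bar\mu,v\rangle\ge0\quad\forall v\in\mathcal{K}(\bar y),$$ where $\mathcal{K}(\bar y)$ is the set of all $v\in H^1_0(\Omega)$ with $|v|=\bar q\,v$ a.e. on $\{\bar y=0\}$ whose positive part $v^+=\max(v,0)$ has zero trace a.e. on $\mathcal{N}_-$ and whose negative part $v^-=\max(-v,0)$ has zero trace a.e. on $\mathcal{N}_+$. 5. (Sign condition) There is $\epsilon>0$ such that for all $u\in L^2(\Omega)$ with $\|u-\bar u\|_{L^2(\Omega)}\le\epsilon$, $$\langle\bar\mu,S(u)-\bar y\rangle-\langle Q(u)-\bar q,\bar p\rangle\ge0.$$ Then $\bar u$ satisfies the quadratic growth condition: there are $\epsilon',\delta>0$ such that $$f(\bar u)\le f(u)-\delta\|u-\bar u\|_{L^2(\Omega)}^2\qquad\text{for all }u\in L^2(\Omega)\text{ with }\|u-\bar u\|_{L^2(\Omega)}\le\epsilon'.$$ -/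

import Mathlib

open MeasureTheory Filter Topology
open scoped ContDiff ENNReal NNReal

noncomputable section

namespace EllipticVI

/-- The Euclidean space `ℝ^d`. -/
abbrev Euc (d : ℕ) : Type := EuclideanSpace ℝ (Fin d)

variable {d : ℕ}

/-- `L²(Ω)`. -/
abbrev L2 (Ω : Set (Euc d)) : Type := Lp ℝ 2 (volume.restrict Ω)

/-- `L²(Ω) × L²(Ω; ℝ^d)` with the Hilbert norm `‖(v, g)‖² = ‖v‖² + ‖g‖²`. On pairs `(v, ∇v)` this
is the `H¹(Ω)` norm. -/
abbrev L2Pair (Ω : Set (Euc d)) : Type :=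
  WithLp 2 (Lp ℝ 2 (volume.restrict Ω) × Lp (Euc d) 2 (volume.restrict Ω))

/-- `φ ∈ C_c^∞(Ω)`. -/
def IsTestFunction (Ω : Set (Euc d)) (φ : Euc d → ℝ) : Prop :=
  ContDiff ℝ ∞ φ ∧ HasCompactSupport φ ∧ tsupport φ ⊆ Ω

/-- `w = (φ, ∇φ)` almost everywhere in `Ω`. -/
def RepresentsFun (Ω : Set (Euc d)) (w : L2Pair Ω) (φ : Euc d → ℝ) : Prop :=
  w.fst =ᵐ[volume.restrict Ω] φ ∧ w.snd =ᵐ[volume.restrict Ω] gradient φ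

/-- `H₀¹(Ω)`: the closure of the test functions in the `H¹(Ω)` norm. An element is the pair
`(v, ∇v)` of a function and its weak gradient. -/
def H01 (Ω : Set (Euc d)) : Submodule ℝ (L2Pair Ω) :=
  (Submodule.span ℝ
    {w : L2Pair Ω | ∃ φ : Euc d → ℝ, IsTestFunction Ω φ ∧ RepresentsFun Ω w φ}).topologicalClosure

/-- The embedding `H₀¹(Ω) → L²(Ω)`. -/
def valL (Ω : Set (Euc d)) : H01 Ω →L[ℝ] L2 Ω :=
  (WithLp.fstL 2 ℝ (Lp ℝ 2 (volume.restrict Ω)) (Lp (Euc d) 2 (volume.restrict Ω))).comp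
    (H01 Ω).subtypeL

/-- The weak gradient `H₀¹(Ω) → L²(Ω; ℝ^d)`. -/
def gradL (Ω : Set (Euc d)) : H01 Ω →L[ℝ] Lp (Euc d) 2 (volume.restrict Ω) :=
  (WithLp.sndL 2 ℝ (Lp ℝ 2 (volume.restrict Ω)) (Lp (Euc d) 2 (volume.restrict Ω))).comp
    (H01 Ω).subtypeL

/-- The bilinear form `a(y, v) = (∇y, ∇v)`. -/
def aForm (Ω : Set (Euc d)) (y v : H01 Ω) : ℝ := inner ℝ (gradL Ω y) (gradL Ω v)

/-- `H⁻¹(Ω)`. -/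
abbrev Hneg1 (Ω : Set (Euc d)) : Type := StrongDual ℝ (H01 Ω)

/-- The embedding `L²(Ω) → H⁻¹(Ω)`, `g ↦ (g, ·)`. -/
def l2ToDual (Ω : Set (Euc d)) (g : L2 Ω) : Hneg1 Ω := (innerSL ℝ g).comp (valL Ω)

/-- The norm of `L¹(Ω)`; for bounded `Ω` every element of `L²(Ω)` is integrable. -/
def l1Norm (Ω : Set (Euc d)) (v : L2 Ω) : ℝ := ∫ x in Ω, |v x|

/-- `y` solves the variational inequality of the second kind with right-hand side `ℓ`. -/
def SolvesVI (Ω : Set (Euc d)) (ℓ : Hneg1 Ω) (y : H01 Ω) : Prop :=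
  ∀ v : H01 Ω,
    ℓ (v - y) ≤ aForm Ω y (v - y) + l1Norm Ω (valL Ω v) - l1Norm Ω (valL Ω y)

/-- The solution operator `S : H⁻¹(Ω) → H₀¹(Ω)` of the variational inequality. -/
def solOp (Ω : Set (Euc d)) (ℓ : Hneg1 Ω) : H01 Ω := Classical.epsilon (SolvesVI Ω ℓ)

/-- `q` is a slack variable for `(ℓ, y)`. The bound `|q| ≤ 1` puts `q` into `L^∞(Ω)`. -/
def IsSlack (Ω : Set (Euc d)) (ℓ : Hneg1 Ω) (y : H01 Ω) (q : L2 Ω) : Prop :=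
  (∀ v : H01 Ω, aForm Ω y v + inner ℝ q (valL Ω v) = ℓ v) ∧
    ∀ᵐ x ∂(volume.restrict Ω), q x * valL Ω y x = |valL Ω y x| ∧ |q x| ≤ 1

/-- The slack variable associated with `S(ℓ)`, as a function on `Ω`. -/
def slack (Ω : Set (Euc d)) (ℓ : Hneg1 Ω) : L2 Ω :=
  Classical.epsilon (IsSlack Ω ℓ (solOp Ω ℓ))

/-- The operator `Q : H⁻¹(Ω) → H⁻¹(Ω)` mapping `ℓ` to its slack variable. -/
def slackOp (Ω : Set (Euc d)) (ℓ : Hneg1 Ω) : Hneg1 Ω := l2ToDual Ω (slack Ω ℓ)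

/-- The objective `J(y, u)`. -/
def objective (Ω : Set (Euc d)) (ν : ℝ) (yd ud : L2 Ω) (y : H01 Ω) (u : L2 Ω) : ℝ :=
  1 / 2 * ‖valL Ω y - yd‖ ^ 2 + ν / 2 * ‖u - ud‖ ^ 2

/-- The reduced objective `f(u) = J(S(u), u)`. -/
def reducedObjective (Ω : Set (Euc d)) (ν : ℝ) (yd ud : L2 Ω) (u : L2 Ω) : ℝ :=
  objective Ω ν yd ud (solOp Ω (l2ToDual Ω u)) u

/-- The quadratic growth condition for `f` at `ubar`. -/
def QuadraticGrowth (Ω : Set (Euc d)) (ν : ℝ) (yd ud ubar : L2 Ω) : Prop :=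
  ∃ ε > (0 : ℝ), ∃ δ > (0 : ℝ), ∀ u : L2 Ω, ‖u - ubar‖ ≤ ε →
    reducedObjective Ω ν yd ud ubar ≤ reducedObjective Ω ν yd ud u - δ * ‖u - ubar‖ ^ 2

/-- `w = (v, g)` lies in `H¹(Ω)`, that is, `g` is the weak gradient of `v`. -/
def MemH1 (Ω : Set (Euc d)) (w : L2Pair Ω) : Prop :=
  ∀ φ : Euc d → ℝ, IsTestFunction Ω φ →
    ∫ x in Ω, w.fst x • gradient φ x = -∫ x in Ω, φ x • w.snd x

/-- The `H¹(ℝ^d)`-capacity: the infimum of `‖v‖²` in `H¹(ℝ^d)` over all `v` with `v ≥ 1` a.e. in an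
open neighbourhood of `A`. -/
def h1Capacity (A : Set (Euc d)) : ℝ≥0∞ :=
  ⨅ (w : L2Pair (Set.univ : Set (Euc d))) (_ : MemH1 Set.univ w)
    (_ : ∃ U : Set (Euc d), IsOpen U ∧ A ⊆ U ∧ ∀ᵐ x, x ∈ U → 1 ≤ w.fst x),
    ENNReal.ofReal (‖w‖ ^ 2)

/-- Strong `(d-1)`-dimensional Lipschitz submanifold of `ℝ^d`: near each of its points, `A` is the
graph, in the direction of a unit vector `e`, of a Lipschitz function on the hyperplane `e^⊥`. -/
def IsStrongLipschitzSubmanifold (A : Set (Euc d)) : Prop :=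
  ∀ x ∈ A, ∃ e : Euc d, ‖e‖ = 1 ∧ ∃ U : Set (Euc d), IsOpen U ∧ x ∈ U ∧
    ∃ (g : ((ℝ ∙ e)ᗮ : Submodule ℝ (Euc d)) → ℝ) (L : ℝ≥0), LipschitzWith L g ∧
      A ∩ U = {z ∈ U | inner ℝ e z = g ((ℝ ∙ e)ᗮ.orthogonalProjectionOnto z)}

/-- The `(d-1)`-dimensional surface measure on `ℝ^d`, for `d ≥ 1`. -/
def surfaceMeasure (d : ℕ) : Measure (Euc d) := Measure.euclideanHausdorffMeasure (d - 1)

/-- `t` is the trace of `z ∈ H₀¹(Ω)` on `A ⊆ Ω`: the continuous extension from test functions `φ`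
to `H₀¹(Ω)` of the restriction `φ ↦ φ|_A` into `L²_loc(A)` with respect to surface measure. -/
def HasTrace (Ω A : Set (Euc d)) (z : H01 Ω) (t : Euc d → ℝ) : Prop :=
  AEStronglyMeasurable t ((surfaceMeasure d).restrict A) ∧
  ∃ (φ : ℕ → Euc d → ℝ) (w : ℕ → H01 Ω),
    (∀ n, IsTestFunction Ω (φ n) ∧ RepresentsFun Ω (w n : L2Pair Ω) (φ n)) ∧
    Tendsto w atTop (𝓝 z) ∧
    ∀ K ⊆ A, IsCompact K →
      Tendsto (fun n => eLpNorm (φ n - t) 2 ((surfaceMeasure d).restrict K)) atTop (𝓝 0)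

/-- The trace of `z` on `A` vanishes almost everywhere on `A`. -/
def TraceVanishes (Ω A : Set (Euc d)) (z : H01 Ω) : Prop :=
  ∃ t : Euc d → ℝ, HasTrace Ω A z t ∧ t =ᵐ[(surfaceMeasure d).restrict A] 0

/-- `{x ∈ Ω : y(x) ≠ 0}`. -/
def inactiveSet (Ω : Set (Euc d)) (Y : Euc d → ℝ) : Set (Euc d) := {x ∈ Ω | Y x ≠ 0}

/-- `∂{y ≠ 0} ∪ ∂Ω`. -/
def freeBoundary (Ω : Set (Euc d)) (Y : Euc d → ℝ) : Set (Euc d) :=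
  frontier (inactiveSet Ω Y) ∪ frontier Ω

/-- `M = {x ∈ Ω : y(x) = 0, ∇y(x) ≠ 0}`. -/
def setM (Ω : Set (Euc d)) (Y : Euc d → ℝ) : Set (Euc d) := {x ∈ Ω | Y x = 0 ∧ gradient Y x ≠ 0}

/-- `N₊ = ({∇y = 0} ∩ ∂{y > 0}) \ C`. -/
def setNPos (Ω : Set (Euc d)) (Y : Euc d → ℝ) (C : Set (Euc d)) : Set (Euc d) :=
  ({x ∈ Ω | gradient Y x = 0} ∩ frontier {x ∈ Ω | 0 < Y x}) \ C

/-- `N₋ = ({∇y = 0} ∩ ∂{y < 0}) \ C`. -/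
def setNNeg (Ω : Set (Euc d)) (Y : Euc d → ℝ) (C : Set (Euc d)) : Set (Euc d) :=
  ({x ∈ Ω | gradient Y x = 0} ∩ frontier {x ∈ Ω | Y x < 0}) \ C

/-- `A` is relatively open in `B`. -/
def IsRelOpen (A B : Set (Euc d)) : Prop := ∃ O : Set (Euc d), IsOpen O ∧ A = O ∩ B

/-- The structural assumption on the active set, with exceptional set `C`. -/
structure ActiveSetStructure (Ω : Set (Euc d)) (Y : Euc d → ℝ) (C : Set (Euc d)) : Prop where
  subset : C ⊆ freeBoundary Ω Y
  closed : IsClosed C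
  capacity : h1Capacity C = 0
  lipschitz : IsStrongLipschitzSubmanifold (freeBoundary Ω Y \ C)
  relOpen_pos : IsRelOpen (setNPos Ω Y C) (freeBoundary Ω Y \ C)
  relOpen_neg : IsRelOpen (setNNeg Ω Y C) (freeBoundary Ω Y \ C)

/-- The space `W_y`: those `z ∈ H₀¹(Ω)` with `∫_M (tr z)² / ‖∇y‖ ds < ∞`. -/
def spaceW (Ω : Set (Euc d)) (Y : Euc d → ℝ) : Set (H01 Ω) :=
  {z | ∃ t : Euc d → ℝ, HasTrace Ω (setM Ω Y) z t ∧
    ∫⁻ x in setM Ω Y, ENNReal.ofReal (t x ^ 2 / ‖gradient Y x‖) ∂(surfaceMeasure d) < ⊤}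

/-- The cone `K(y)`: all `v ∈ W_y` with `|v| = q v` a.e. on `{y = 0}`, with `tr (v⁺) = 0` a.e. on
`N₋` and `tr (v⁻) = 0` a.e. on `N₊`; here `v⁺ = max (v, 0)` and `v⁻ = max (-v, 0)`. -/
def coneK (Ω : Set (Euc d)) (Y : Euc d → ℝ) (C : Set (Euc d)) (q : L2 Ω) : Set (H01 Ω) :=
  {v | v ∈ spaceW Ω Y ∧
    (∀ᵐ x ∂(volume.restrict Ω), Y x = 0 → |valL Ω v x| = q x * valL Ω v x) ∧
    (∃ vp : H01 Ω, (valL Ω vp =ᵐ[volume.restrict Ω] fun x => max (valL Ω v x) 0) ∧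
      TraceVanishes Ω (setNNeg Ω Y C) vp) ∧
    (∃ vm : H01 Ω, (valL Ω vm =ᵐ[volume.restrict Ω] fun x => max (-valL Ω v x) 0) ∧
      TraceVanishes Ω (setNPos Ω Y C) vm)}

/-- The strong stationarity system for the control `u`, the state `y` (with `C¹` representative `Y`),
the slack variable `q`, the adjoint state `p` and a multiplier `mu ∈ H⁻¹(Ω)`. -/
structure StrongStationarity (Ω : Set (Euc d)) (ν : ℝ) (yd ud u : L2 Ω) (y : H01 Ω)
    (Y : Euc d → ℝ) (C : Set (Euc d)) (q : L2 Ω) (p : H01 Ω) (mu : Hneg1 Ω) : Prop where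
  gradient_eq : valL Ω p + ν • (u - ud) = 0
  adjoint_eq : ∀ v ∈ spaceW Ω Y, ∀ tp tv : Euc d → ℝ,
    HasTrace Ω (setM Ω Y) p tp → HasTrace Ω (setM Ω Y) v tv →
    aForm Ω p v + 2 * ∫ x in setM Ω Y, tp x * tv x / ‖gradient Y x‖ ∂(surfaceMeasure d)
      = inner ℝ (valL Ω y - yd) (valL Ω v) - mu v
  adjoint_mem : p ∈ coneK Ω Y C q
  multiplier_nonneg : ∀ v ∈ coneK Ω Y C q, 0 ≤ mu v

end EllipticVI

end

/-!
The existence theory for `S` and `Q` is convex duality. By Poincaré's inequality the gradient is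
bounded below on `H₀¹(Ω)`, so that `H₀¹(Ω)` can be measured in the energy norm. The Moreau
decomposition of the right-hand side with respect to the seminorm `‖·‖_{L¹}` in that Hilbert space
produces the state together with a functional dominated by `‖·‖_{L¹}`; Hahn–Banach extends this
functional to `L²(Ω)`, where it is represented by the slack variable.

Since `M` is empty, the adjoint equation contains no surface term. Testing the state equations of
`u` and `ubar` with the adjoint state `p` then cancels every linear term in the expansion of the
objective around `ubar`. What remains is
`‖S(u) - ybar‖² / 2 + ν ‖u - ubar‖² / 2 + (⟨mu, S(u) - ybar⟩ - ⟨Q(u) - qbar, p⟩)`,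
whose last term is nonnegative by the sign condition.
-/

namespace EllipticVI

section ConvexDuality

variable {H E L : Type*} [NormedAddCommGroup E] [InnerProductSpace ℝ E]
  [NormedAddCommGroup L] [NormedSpace ℝ L]

theorem exists_strongDual_le_seminorm_comp_eq [AddCommGroup H] [Module ℝ H]
    (V : H →ₗ[ℝ] L) (N : Seminorm ℝ L) (hN : Continuous N) (φ : H →ₗ[ℝ] ℝ)
    (hφ : ∀ v, φ v ≤ N (V v)) :
    ∃ q : StrongDual ℝ L, (∀ w, q w ≤ N w) ∧ ∀ v, q (V v) = φ v := by
  obtain ⟨s, hs⟩ := V.rangeRestrict.exists_rightInverse_of_surjective V.range_rangeRestrict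
  have hVs (w : V.range) : V (s w) = w := congrArg Subtype.val (LinearMap.congr_fun hs w)
  have hφs (v : H) : φ (s (V.rangeRestrict v)) = φ v := by
    have h := (N.comp V).abs_le_of_le hφ (s (V.rangeRestrict v) - v)
    simpa [hVs, sub_eq_zero] using h
  obtain ⟨q, hqφ, hqN⟩ := Module.Dual.exists_continuous_extension_of_le_seminorm_real V.range
    (φ ∘ₗ s) hN fun w => (hφ (s w)).trans_eq (congrArg N (hVs w))
  exact ⟨q, fun w => (le_abs_self _).trans (hqN w), fun v =>
    (hqφ (V.rangeRestrict v)).trans (hφs v)⟩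

theorem exists_strongDual_le_seminorm_apply_eq (N : Seminorm ℝ L) (hN : Continuous N)
    (y : L) : ∃ q : StrongDual ℝ L, (∀ w, q w ≤ N w) ∧ q y = N y := by
  obtain ⟨q, hqN, hq⟩ := exists_strongDual_le_seminorm_comp_eq (LinearMap.toSpanSingleton ℝ L y) N
    hN (LinearMap.toSpanSingleton ℝ ℝ (N y)) fun t => by
      simpa [map_smul_eq_mul] using mul_le_mul_of_nonneg_right (le_abs_self t) (apply_nonneg N y)
  exact ⟨q, hqN, by simpa using hq 1⟩

/-- The projection `p` of `x` onto the polar set of `N` leaves a remainder `y` at which `p` attains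
the support function `N` of that set. -/
theorem exists_moreau_decomposition [CompleteSpace E] (N : Seminorm ℝ E) (hN : Continuous N)
    (x : E) : ∃ y p : E, y + p = x ∧ (∀ v, inner ℝ p v ≤ N v) ∧ inner ℝ p y = N y := by
  let K : Set E := {p | ∀ v, inner ℝ p v ≤ N v}
  have hK : K = ⋂ v, {p | innerSL ℝ v p ≤ N v} := by
    ext p
    simp only [K, Set.mem_iInter, Set.mem_ofPred_eq, innerSL_apply_apply, real_inner_comm p]
  have hclosed : IsClosed K :=
    hK ▸ isClosed_iInter fun v => isClosed_le (innerSL ℝ v).continuous continuous_const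
  have hconvex : Convex ℝ K :=
    hK ▸ convex_iInter fun v => convex_halfSpace_le (innerSL ℝ v).isLinear _
  obtain ⟨p, hp, hmin⟩ := exists_norm_eq_iInf_of_complete_convex
    ⟨0, fun v => by simp⟩ hclosed.isComplete hconvex x
  have hproj : ∀ p' ∈ K, inner ℝ (x - p) (p' - p) ≤ 0 :=
    (norm_eq_iInf_iff_real_inner_le_zero hconvex hp).1 hmin
  obtain ⟨q, hqN, hq⟩ := exists_strongDual_le_seminorm_apply_eq N hN (x - p)
  have hqp : N (x - p) ≤ inner ℝ p (x - p) := by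
    have h := hproj ((InnerProductSpace.toDual ℝ E).symm q) fun v => by
      simpa only [InnerProductSpace.toDual_symm_apply] using hqN v
    rw [real_inner_comm, inner_sub_left, InnerProductSpace.toDual_symm_apply, hq] at h
    exact sub_nonpos.1 h
  exact ⟨x - p, p, sub_add_cancel x p, hp, (hp _).antisymm hqp⟩

theorem exists_inner_add_strongDual_eq [NormedAddCommGroup H] [NormedSpace ℝ H]
    [CompleteSpace H] [CompleteSpace E] {D : H →L[ℝ] E} {κ : ℝ≥0} (hD : AntilipschitzWith κ D)
    (N : Seminorm ℝ H) (hN : Continuous N) (ℓ : StrongDual ℝ H) :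
    ∃ (y : H) (φ : StrongDual ℝ H), (∀ v, inner ℝ (D y) (D v) + φ v = ℓ v) ∧
      (∀ v, φ v ≤ N v) ∧ φ y = N y := by
  have hrange : IsClosed (Set.range D) := hD.isClosed_range D.uniformContinuous
  have : CompleteSpace D.range := hrange.completeSpace_coe
  let T : H ≃L[ℝ] D.range := D.equivRange hD.injective hrange
  let x : D.range := (InnerProductSpace.toDual ℝ D.range).symm (ℓ ∘L T.symm)
  obtain ⟨y, p, hyp, hpN, hpy⟩ := exists_moreau_decomposition
    (N.comp (T.symm : D.range →ₗ[ℝ] H)) (hN.comp T.symm.continuous) x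
  refine ⟨T.symm y, innerSL ℝ p ∘L T, fun v => ?_, fun v => ?_, ?_⟩
  · calc inner ℝ (D (T.symm y)) (D v) + inner ℝ p (T v)
        = inner ℝ (T (T.symm y)) (T v) + inner ℝ p (T v) := rfl
      _ = inner ℝ x (T v) := by rw [T.apply_symm_apply, ← inner_add_left, hyp]
      _ = ℓ v := by simp [x, InnerProductSpace.toDual_symm_apply]
  · simpa using hpN (T v)
  · simpa using hpy

end ConvexDuality

section L1Seminorm

variable {α : Type*} [MeasurableSpace α] {μ : Measure α} [IsFiniteMeasure μ]

theorem integrable_abs_coeFn_Lp_two (w : Lp ℝ 2 μ) : Integrable (fun x => |w x|) μ :=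
  ((Lp.memLp w).integrable one_le_two).abs

variable (μ) in
/-- The `L¹` norm on `L²` of a finite measure space, bundled as a seminorm; `l1Norm Ω` is the
underlying function for Lebesgue measure on `Ω`. -/
noncomputable def l1Seminorm : Seminorm ℝ (Lp ℝ 2 μ) :=
  Seminorm.of (fun w => ∫ x, |w x| ∂μ)
    (fun v w => by
      rw [← integral_add (integrable_abs_coeFn_Lp_two v) (integrable_abs_coeFn_Lp_two w)]
      refine integral_mono_ae (integrable_abs_coeFn_Lp_two _)
        ((integrable_abs_coeFn_Lp_two v).add (integrable_abs_coeFn_Lp_two w)) ?_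
      filter_upwards [Lp.coeFn_add v w] with x hx
      rw [hx, Pi.add_apply]
      exact abs_add_le _ _)
    (fun c w => by
      rw [← integral_const_mul]
      refine integral_congr_ae ?_
      filter_upwards [Lp.coeFn_smul c w] with x hx
      rw [hx, Pi.smul_apply, smul_eq_mul, abs_mul, Real.norm_eq_abs])

theorem l1Seminorm_eq_inner (w : Lp ℝ 2 μ) :
    l1Seminorm μ w = inner ℝ (Lp.const 2 μ (1 : ℝ)) |w| := by
  rw [L2.inner_def]
  refine integral_congr_ae ?_
  filter_upwards [Lp.coeFn_const 2 μ (1 : ℝ), Lp.coeFn_abs w] with x h1 hw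
  rw [h1, hw]
  simp

theorem continuous_l1Seminorm : Continuous (l1Seminorm μ) := by
  simp only [funext l1Seminorm_eq_inner]
  exact continuous_const.inner (continuous_id.sup continuous_neg)

theorem l1Seminorm_indicatorConstLp {s : Set α} (hs : MeasurableSet s) (c : ℝ) :
    l1Seminorm μ (indicatorConstLp 2 hs (measure_ne_top μ s) c) = ∫ _ in s, |c| ∂μ := by
  rw [← integral_indicator hs]
  refine integral_congr_ae ?_
  filter_upwards [indicatorConstLp_coeFn (p := 2) (hs := hs) (hμs := measure_ne_top μ s) (c := c)]
    with x hx
  by_cases hxs : x ∈ s <;> simp [hx, hxs]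

theorem mul_le_abs_of_abs_le_one {a : ℝ} (ha : |a| ≤ 1) (b : ℝ) : a * b ≤ |b| :=
  calc a * b ≤ |a| * |b| := (le_abs_self _).trans_eq (abs_mul a b)
    _ ≤ |b| := mul_le_of_le_one_left (abs_nonneg b) ha

theorem forall_inner_le_l1Seminorm_iff (q : Lp ℝ 2 μ) :
    (∀ w, inner ℝ q w ≤ l1Seminorm μ w) ↔ ∀ᵐ x ∂μ, |q x| ≤ 1 := by
  constructor
  · intro h
    have hle (c : ℝ) (hc : |c| = 1) : ∀ᵐ x ∂μ, c * q x ≤ 1 := by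
      refine ae_le_of_forall_setIntegral_le
        (((Lp.memLp q).integrable one_le_two).const_mul c) (integrable_const 1) fun s hs _ => ?_
      have hsq := h (indicatorConstLp 2 hs (measure_ne_top μ s) c)
      rw [real_inner_comm, L2.inner_indicatorConstLp_eq_setIntegral_inner,
        l1Seminorm_indicatorConstLp, hc] at hsq
      simpa [mul_comm] using hsq
    filter_upwards [hle 1 (by simp), hle (-1) (by simp)] with x h1 h2
    exact abs_le.2 ⟨by linarith, by linarith⟩
  · intro h w
    rw [L2.inner_def]
    refine integral_mono_ae (L2.integrable_inner q w) (integrable_abs_coeFn_Lp_two w) ?_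
    filter_upwards [h] with x hx
    simpa [mul_comm] using mul_le_abs_of_abs_le_one hx (w x)

theorem inner_eq_l1Seminorm_iff {q y : Lp ℝ 2 μ} (hq : ∀ᵐ x ∂μ, |q x| ≤ 1) :
    inner ℝ q y = l1Seminorm μ y ↔ ∀ᵐ x ∂μ, q x * y x = |y x| := by
  have hinner (x : α) : inner ℝ (q x) (y x) = q x * y x := by simp [mul_comm]
  rw [L2.inner_def]
  simp only [hinner]
  refine integral_eq_iff_of_ae_le (by simpa only [hinner] using L2.integrable_inner (𝕜 := ℝ) q y)
    (integrable_abs_coeFn_Lp_two y) ?_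
  filter_upwards [hq] with x hx using mul_le_abs_of_abs_le_one hx (y x)

end L1Seminorm

section Poincare

section Fderiv

variable {E : Type*} [NormedAddCommGroup E] [NormedSpace ℝ E] [FiniteDimensional ℝ E]
  [MeasurableSpace E] [BorelSpace E] {μ : Measure E} [μ.IsAddHaarMeasure] {φ : E → ℝ}
  {c : StrongDual ℝ E} {e : E}

theorem integral_mul_mul_fderiv_eq_neg_integral_sq (hφ : ContDiff ℝ 1 φ)
    (hsupp : HasCompactSupport φ) (hce : c e = 1) :
    ∫ x, c x * (2 * φ x * fderiv ℝ φ x e) ∂μ = -∫ x, φ x ^ 2 ∂μ := by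
  have hdiff : Differentiable ℝ φ := hφ.differentiable one_ne_zero
  have hderiv (x : E) : fderiv ℝ (fun x => φ x ^ 2) x e = 2 * φ x * fderiv ℝ φ x e := by
    simp [fderiv_fun_pow 2 (hdiff x)]
  have hcont : Continuous φ := hφ.continuous
  have : Continuous fun x => fderiv ℝ φ x e :=
    (hφ.continuous_fderiv one_ne_zero).clm_apply continuous_const
  have hsq : HasCompactSupport fun x => φ x ^ 2 :=
    hsupp.comp_left (g := fun t : ℝ => t ^ 2) (by simp)
  have hmul : HasCompactSupport fun x => 2 * φ x * fderiv ℝ φ x e := hsupp.mul_left.mul_right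
  have h := integral_mul_fderiv_eq_neg_fderiv_mul_of_integrable (μ := μ) (f := c)
    (g := fun x => φ x ^ 2) (v := e)
    (Continuous.integrable_of_hasCompactSupport (by fun_prop) (hsq.mul_left (f := fun _ => _)))
    (by
      simp only [hderiv]
      exact Continuous.integrable_of_hasCompactSupport (by fun_prop) hmul.mul_left)
    (Continuous.integrable_of_hasCompactSupport (by fun_prop) hsq.mul_left)
    (fun x _ => c.differentiableAt) fun x _ => (hdiff x).fun_pow 2
  simpa only [hderiv, ContinuousLinearMap.fderiv, hce, one_mul] using h

theorem integral_sq_le_integral_fderiv_sq (hφ : ContDiff ℝ 1 φ) (hsupp : HasCompactSupport φ)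
    (hce : c e = 1) {R : ℝ} (hR : ∀ x ∈ tsupport φ, |c x| ≤ R) :
    ∫ x, φ x ^ 2 ∂μ ≤ 4 * R ^ 2 * ∫ x, fderiv ℝ φ x e ^ 2 ∂μ := by
  have hcont : Continuous φ := hφ.continuous
  have hcont' : Continuous fun x => fderiv ℝ φ x e :=
    (hφ.continuous_fderiv one_ne_zero).clm_apply continuous_const
  have hsupp' : HasCompactSupport fun x => fderiv ℝ φ x e := hsupp.fderiv_apply ℝ e
  have hint : Integrable (fun x => φ x ^ 2) μ :=
    (hcont.memLp_of_hasCompactSupport hsupp).integrable_sq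
  have hint' : Integrable (fun x => fderiv ℝ φ x e ^ 2) μ :=
    (hcont'.memLp_of_hasCompactSupport hsupp').integrable_sq
  have hintmul : Integrable (fun x => c x * (2 * φ x * fderiv ℝ φ x e)) μ :=
    Continuous.integrable_of_hasCompactSupport (by fun_prop) hsupp.mul_left.mul_right.mul_left
  have hyoung (x : E) : -(c x * (2 * φ x * fderiv ℝ φ x e)) ≤
      1 / 2 * φ x ^ 2 + 2 * R ^ 2 * fderiv ℝ φ x e ^ 2 := by
    by_cases hx : x ∈ tsupport φ
    · have hc : c x ^ 2 * fderiv ℝ φ x e ^ 2 ≤ R ^ 2 * fderiv ℝ φ x e ^ 2 :=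
        mul_le_mul_of_nonneg_right (sq_le_sq.2 ((hR x hx).trans (le_abs_self R))) (sq_nonneg _)
      nlinarith [sq_nonneg (φ x + 2 * (c x * fderiv ℝ φ x e))]
    · rw [image_eq_zero_of_notMem_tsupport hx]
      simp only [mul_zero, zero_mul, neg_zero]
      positivity
  have h : ∫ x, φ x ^ 2 ∂μ ≤ 1 / 2 * ∫ x, φ x ^ 2 ∂μ + 2 * R ^ 2 * ∫ x, fderiv ℝ φ x e ^ 2 ∂μ :=
    calc ∫ x, φ x ^ 2 ∂μ = ∫ x, -(c x * (2 * φ x * fderiv ℝ φ x e)) ∂μ := by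
          rw [integral_neg, integral_mul_mul_fderiv_eq_neg_integral_sq hφ hsupp hce, neg_neg]
      _ ≤ ∫ x, 1 / 2 * φ x ^ 2 + 2 * R ^ 2 * fderiv ℝ φ x e ^ 2 ∂μ :=
          integral_mono hintmul.neg ((hint.const_mul _).add (hint'.const_mul _)) hyoung
      _ = _ := by
          rw [integral_add (hint.const_mul _) (hint'.const_mul _), integral_const_mul,
            integral_const_mul]
  linarith

end Fderiv

section Slab

variable {E : Type*} [NormedAddCommGroup E] [InnerProductSpace ℝ E]

/-- `Ω` lies between two parallel hyperplanes, here centred at the origin. Boundedness in a single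
direction is all that the Poincaré inequality needs. -/
def LiesInSlab (Ω : Set E) : Prop :=
  ∃ e : E, ‖e‖ = 1 ∧ ∃ R : ℝ, ∀ x ∈ Ω, |inner ℝ e x| ≤ R

theorem LiesInSlab.of_isBounded [Nontrivial E] {Ω : Set E} (hΩ : Bornology.IsBounded Ω) :
    LiesInSlab Ω := by
  obtain ⟨e, he⟩ := exists_norm_eq E zero_le_one
  obtain ⟨R, hR⟩ := hΩ.exists_norm_le
  refine ⟨e, he, R, fun x hx => (abs_real_inner_le_norm e x).trans ?_⟩
  simpa only [he, one_mul] using hR x hx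

theorem norm_gradient [CompleteSpace E] (φ : E → ℝ) (x : E) : ‖gradient φ x‖ = ‖fderiv ℝ φ x‖ :=
  LinearIsometryEquiv.norm_map _ _

theorem integral_sq_le_integral_norm_gradient_sq [FiniteDimensional ℝ E] [MeasurableSpace E]
    [BorelSpace E] {μ : Measure E} [μ.IsAddHaarMeasure] {φ : E → ℝ} (hφ : ContDiff ℝ 1 φ)
    (hsupp : HasCompactSupport φ) {e : E} (he : ‖e‖ = 1) {R : ℝ}
    (hR : ∀ x ∈ tsupport φ, |inner ℝ e x| ≤ R) :
    ∫ x, φ x ^ 2 ∂μ ≤ 4 * R ^ 2 * ∫ x, ‖gradient φ x‖ ^ 2 ∂μ := by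
  have hcont' : Continuous (fderiv ℝ φ) := hφ.continuous_fderiv one_ne_zero
  refine (integral_sq_le_integral_fderiv_sq hφ hsupp (c := innerSL ℝ e) (e := e)
    (by simp [he]) hR).trans ?_
  gcongr 4 * R ^ 2 * ?_
  simp only [norm_gradient]
  refine integral_mono
    ((hcont'.clm_apply continuous_const).memLp_of_hasCompactSupport
      (hsupp.fderiv_apply ℝ e)).integrable_sq
    (hcont'.norm.memLp_of_hasCompactSupport (hsupp.fderiv ℝ).norm).integrable_sq fun x => ?_
  exact sq_le_sq.2 (by simpa [he] using (fderiv ℝ φ x).le_opNorm e)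

end Slab

theorem norm_sq_eq_integral_norm_sq {α F : Type*} [MeasurableSpace α] {μ : Measure α}
    [NormedAddCommGroup F] [InnerProductSpace ℝ F] (f : Lp F 2 μ) :
    ‖f‖ ^ 2 = ∫ x, ‖f x‖ ^ 2 ∂μ := by
  simp only [← real_inner_self_eq_norm_sq, L2.inner_def]

end Poincare

section TestFunctions

variable {d : ℕ} {Ω : Set (Euc d)} {φ ψ : Euc d → ℝ} {w z : L2Pair Ω}

theorem IsTestFunction.zero : IsTestFunction Ω (0 : Euc d → ℝ) :=
  ⟨contDiff_const, HasCompactSupport.zero, by simp [tsupport]⟩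

theorem IsTestFunction.add (hφ : IsTestFunction Ω φ) (hψ : IsTestFunction Ω ψ) :
    IsTestFunction Ω (φ + ψ) :=
  ⟨hφ.1.add hψ.1, hφ.2.1.add hψ.2.1, (tsupport_add φ ψ).trans (Set.union_subset hφ.2.2 hψ.2.2)⟩

theorem IsTestFunction.const_smul (c : ℝ) (hφ : IsTestFunction Ω φ) : IsTestFunction Ω (c • φ) :=
  ⟨hφ.1.const_smul c, hφ.2.1.smul_left (f := fun _ => c),
    (tsupport_smul_subset_right (fun _ => c) φ).trans hφ.2.2⟩

theorem IsTestFunction.differentiable (hφ : IsTestFunction Ω φ) : Differentiable ℝ φ :=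
  hφ.1.differentiable (by simp)

theorem RepresentsFun.zero : RepresentsFun Ω 0 (0 : Euc d → ℝ) := by
  refine ⟨Lp.coeFn_zero _ _ _, ?_⟩
  rw [show gradient (0 : Euc d → ℝ) = 0 from gradient_const' (F := Euc d) (0 : ℝ)]
  exact Lp.coeFn_zero _ _ _

theorem RepresentsFun.add (hw : RepresentsFun Ω w φ) (hz : RepresentsFun Ω z ψ)
    (hφ : Differentiable ℝ φ) (hψ : Differentiable ℝ ψ) : RepresentsFun Ω (w + z) (φ + ψ) := by
  refine ⟨(Lp.coeFn_add _ _).trans (hw.1.add hz.1), (Lp.coeFn_add _ _).trans ?_⟩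
  filter_upwards [hw.2, hz.2] with x hwx hzx
  refine (congrArg₂ (· + ·) hwx hzx).trans ?_
  simp only [gradient, fderiv_add (hφ x) (hψ x), map_add]

theorem RepresentsFun.const_smul (c : ℝ) (hw : RepresentsFun Ω w φ) (hφ : Differentiable ℝ φ) :
    RepresentsFun Ω (c • w) (c • φ) := by
  refine ⟨(Lp.coeFn_smul _ _).trans (hw.1.const_smul c), (Lp.coeFn_smul _ _).trans ?_⟩
  filter_upwards [hw.2] with x hwx
  refine (congrArg (c • ·) hwx).trans ?_
  simp [gradient, fderiv_const_smul (hφ x)]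

variable (Ω) in
/-- The pairs `(φ, ∇φ)` of test functions and their gradients. They form a subspace already, so
that `H₀¹(Ω)` is their closure. -/
def testPairs : Submodule ℝ (L2Pair Ω) where
  carrier := {w | ∃ φ : Euc d → ℝ, IsTestFunction Ω φ ∧ RepresentsFun Ω w φ}
  zero_mem' := ⟨0, .zero, .zero⟩
  add_mem' := fun ⟨_, hφ, hw⟩ ⟨_, hψ, hz⟩ =>
    ⟨_, hφ.add hψ, hw.add hz hφ.differentiable hψ.differentiable⟩
  smul_mem' := fun c _ ⟨_, hφ, hw⟩ => ⟨_, hφ.const_smul c, hw.const_smul c hφ.differentiable⟩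

theorem topologicalClosure_testPairs : (testPairs Ω).topologicalClosure = H01 Ω :=
  congrArg Submodule.topologicalClosure (Submodule.span_eq (testPairs Ω)).symm

theorem hasTrace_empty (z : H01 Ω) : HasTrace Ω ∅ z 0 := by
  have hz : (z : L2Pair Ω) ∈ closure (testPairs Ω : Set (L2Pair Ω)) := by
    rw [← Submodule.topologicalClosure_coe, topologicalClosure_testPairs]
    exact z.2
  obtain ⟨w, hw, hlim⟩ := mem_closure_iff_seq_limit.1 hz
  choose φ hφ using hw
  have hwH (n : ℕ) : w n ∈ H01 Ω :=
    topologicalClosure_testPairs.le (Submodule.le_topologicalClosure _ ⟨φ n, hφ n⟩)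
  refine ⟨aestronglyMeasurable_const, φ, fun n => ⟨w n, hwH n⟩, hφ, tendsto_subtype_rng.2 hlim,
    fun K hK _ => ?_⟩
  simp [Set.subset_empty_iff.1 hK]

theorem StrongStationarity.aForm_eq {ν : ℝ} {yd ud u : L2 Ω} {y : H01 Ω} {Y : Euc d → ℝ}
    {C : Set (Euc d)} {q : L2 Ω} {p : H01 Ω} {mu : Hneg1 Ω}
    (h : StrongStationarity Ω ν yd ud u y Y C q p mu) (hM : setM Ω Y = ∅) (v : H01 Ω) :
    aForm Ω p v = inner ℝ (valL Ω y - yd) (valL Ω v) - mu v := by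
  have htrace (z : H01 Ω) : HasTrace Ω (setM Ω Y) z 0 := hM ▸ hasTrace_empty z
  simpa [hM] using h.adjoint_eq v ⟨0, htrace v, by simp [hM]⟩ 0 0 (htrace p) (htrace v)

theorem IsTestFunction.setIntegral_sq_le {e : Euc d} (hφ : IsTestFunction Ω φ) (he : ‖e‖ = 1)
    {R : ℝ} (hR : ∀ x ∈ Ω, |inner ℝ e x| ≤ R) :
    ∫ x in Ω, φ x ^ 2 ≤ 4 * R ^ 2 * ∫ x in Ω, ‖gradient φ x‖ ^ 2 := by
  have hzero (x : Euc d) (hx : x ∉ Ω) : φ x ^ 2 = 0 := by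
    rw [image_eq_zero_of_notMem_tsupport fun h => hx (hφ.2.2 h), zero_pow two_ne_zero]
  have hzero' (x : Euc d) (hx : x ∉ Ω) : ‖gradient φ x‖ ^ 2 = 0 := by
    rw [norm_gradient, image_eq_zero_of_notMem_tsupport fun h =>
      hx (hφ.2.2 (tsupport_fderiv_subset ℝ h)), norm_zero, zero_pow two_ne_zero]
  rw [setIntegral_eq_integral_of_forall_compl_eq_zero hzero,
    setIntegral_eq_integral_of_forall_compl_eq_zero hzero']
  exact integral_sq_le_integral_norm_gradient_sq (hφ.1.of_le (by simp)) hφ.2.1 he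
    fun x hx => hR x (hφ.2.2 hx)

theorem norm_fst_sq_le_of_mem_H01 {e : Euc d} (he : ‖e‖ = 1) {R : ℝ}
    (hR : ∀ x ∈ Ω, |inner ℝ e x| ≤ R) (hw : w ∈ H01 Ω) :
    ‖w.fst‖ ^ 2 ≤ 4 * R ^ 2 * ‖w.snd‖ ^ 2 := by
  have hclosed : IsClosed {w : L2Pair Ω | ‖w.fst‖ ^ 2 ≤ 4 * R ^ 2 * ‖w.snd‖ ^ 2} :=
    isClosed_le (by fun_prop) (by fun_prop)
  rw [← topologicalClosure_testPairs, ← SetLike.mem_coe, Submodule.topologicalClosure_coe] at hw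
  refine closure_minimal ?_ hclosed hw
  rintro z ⟨φ, hφ, hz⟩
  have hfst : ‖z.fst‖ ^ 2 = ∫ x in Ω, φ x ^ 2 := by
    rw [norm_sq_eq_integral_norm_sq]
    exact integral_congr_ae (hz.1.mono fun x hx => by simp [hx])
  have hsnd : ‖z.snd‖ ^ 2 = ∫ x in Ω, ‖gradient φ x‖ ^ 2 := by
    rw [norm_sq_eq_integral_norm_sq]
    exact integral_congr_ae (hz.2.mono fun x hx => by simp only [hx])
  rw [Set.mem_ofPred_eq, hfst, hsnd]
  exact hφ.setIntegral_sq_le he hR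

theorem exists_antilipschitzWith_gradL (hΩ : LiesInSlab Ω) :
    ∃ κ : ℝ≥0, AntilipschitzWith κ (gradL Ω) := by
  obtain ⟨e, he, R, hR⟩ := hΩ
  have hbound (v : H01 Ω) : ‖v‖ ≤ √(4 * R ^ 2 + 1) * ‖gradL Ω v‖ := by
    have hval : ‖valL Ω v‖ ^ 2 ≤ 4 * R ^ 2 * ‖gradL Ω v‖ ^ 2 := norm_fst_sq_le_of_mem_H01 he hR v.2
    refine le_of_sq_le_sq ?_ (by positivity)
    calc ‖v‖ ^ 2 = ‖valL Ω v‖ ^ 2 + ‖gradL Ω v‖ ^ 2 :=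
          WithLp.prod_norm_sq_eq_of_L2 (v : L2Pair Ω)
      _ ≤ (4 * R ^ 2 + 1) * ‖gradL Ω v‖ ^ 2 := by linarith
      _ = (√(4 * R ^ 2 + 1) * ‖gradL Ω v‖) ^ 2 := by
          rw [mul_pow, Real.sq_sqrt (by positivity)]
  exact ⟨⟨_, Real.sqrt_nonneg _⟩, (gradL Ω).antilipschitz_of_bound hbound⟩

end TestFunctions

section Solution

variable {d : ℕ} {Ω : Set (Euc d)} {ℓ : Hneg1 Ω} {y : H01 Ω} {q : L2 Ω}

theorem SolvesVI.norm_gradL_sub_sq_le {ℓ' : Hneg1 Ω} {y' : H01 Ω} (hy : SolvesVI Ω ℓ y)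
    (hy' : SolvesVI Ω ℓ' y') : ‖gradL Ω (y - y')‖ ^ 2 ≤ (ℓ - ℓ') (y - y') := by
  have h := add_le_add (hy y') (hy' y)
  simp only [aForm, map_sub, inner_sub_right] at h
  rw [← real_inner_self_eq_norm_sq]
  simp only [map_sub, sub_apply, inner_sub_left, inner_sub_right]
  linarith

theorem SolvesVI.unique (hΩ : LiesInSlab Ω) {y' : H01 Ω} (hy : SolvesVI Ω ℓ y)
    (hy' : SolvesVI Ω ℓ y') : y = y' := by
  obtain ⟨κ, hκ⟩ := exists_antilipschitzWith_gradL hΩ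
  have h := hy.norm_gradL_sub_sq_le hy'
  rw [sub_self, zero_apply, sq_nonpos_iff, norm_eq_zero, map_sub, sub_eq_zero] at h
  exact hκ.injective h

variable [IsFiniteMeasure (volume.restrict Ω)]

theorem exists_isSlack (hΩ : LiesInSlab Ω) (ℓ : Hneg1 Ω) :
    ∃ (y : H01 Ω) (q : L2 Ω), IsSlack Ω ℓ y q := by
  obtain ⟨κ, hκ⟩ := exists_antilipschitzWith_gradL hΩ
  have : CompleteSpace (H01 Ω) := (Submodule.isClosed_topologicalClosure _).completeSpace_coe
  let N : Seminorm ℝ (L2 Ω) := l1Seminorm (volume.restrict Ω)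
  let V : H01 Ω →ₗ[ℝ] L2 Ω := valL Ω
  have hN : Continuous N := continuous_l1Seminorm
  obtain ⟨y, φ, hstate, hφN, hφy⟩ := exists_inner_add_strongDual_eq hκ (N.comp V)
    (hN.comp (valL Ω).continuous) ℓ
  obtain ⟨f, hfN, hfφ⟩ :=
    exists_strongDual_le_seminorm_comp_eq V N hN (φ : H01 Ω →ₗ[ℝ] ℝ) hφN
  let q : L2 Ω := (InnerProductSpace.toDual ℝ (L2 Ω)).symm f
  have hq (w : L2 Ω) : inner ℝ q w = f w := InnerProductSpace.toDual_symm_apply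
  have hq1 : ∀ᵐ x ∂volume.restrict Ω, |q x| ≤ 1 :=
    (forall_inner_le_l1Seminorm_iff q).1 fun w => (hq w).trans_le (hfN w)
  have hqφ (v : H01 Ω) : inner ℝ q (valL Ω v) = φ v := (hq _).trans (hfφ v)
  have hqy : ∀ᵐ x ∂volume.restrict Ω, q x * valL Ω y x = |valL Ω y x| :=
    (inner_eq_l1Seminorm_iff hq1).1 ((hqφ y).trans hφy)
  exact ⟨y, q, fun v => by simpa only [aForm, hqφ] using hstate v, hqy.and hq1⟩

theorem IsSlack.solvesVI (h : IsSlack Ω ℓ y q) : SolvesVI Ω ℓ y := by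
  intro v
  have hq1 : ∀ᵐ x ∂volume.restrict Ω, |q x| ≤ 1 := h.2.mono fun _ hx => hx.2
  have hqv : inner ℝ q (valL Ω v) ≤ l1Norm Ω (valL Ω v) :=
    (forall_inner_le_l1Seminorm_iff q).2 hq1 _
  have hqy : inner ℝ q (valL Ω y) = l1Norm Ω (valL Ω y) :=
    (inner_eq_l1Seminorm_iff hq1).2 (h.2.mono fun _ hx => hx.1)
  rw [← h.1, map_sub, inner_sub_right, hqy]
  linarith

theorem isSlack_slack (hΩ : LiesInSlab Ω) (ℓ : Hneg1 Ω) :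
    IsSlack Ω ℓ (solOp Ω ℓ) (slack Ω ℓ) := by
  obtain ⟨y, q, h⟩ := exists_isSlack hΩ ℓ
  have hy : y = solOp Ω ℓ :=
    h.solvesVI.unique hΩ (Classical.epsilon_spec (p := SolvesVI Ω ℓ) ⟨y, h.solvesVI⟩)
  exact Classical.epsilon_spec (p := IsSlack Ω ℓ (solOp Ω ℓ)) ⟨q, hy ▸ h⟩

end Solution

section Objective

variable {d : ℕ} {Ω : Set (Euc d)} {ν : ℝ} {yd ud u ubar q qbar : L2 Ω} {y ybar p : H01 Ω}
  {mu : Hneg1 Ω}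

theorem objective_eq_add_of_stationary
    (hu : ∀ v, aForm Ω y v + inner ℝ q (valL Ω v) = l2ToDual Ω u v)
    (hubar : ∀ v, aForm Ω ybar v + inner ℝ qbar (valL Ω v) = l2ToDual Ω ubar v)
    (hgrad : valL Ω p + ν • (ubar - ud) = 0)
    (hadj : ∀ v, aForm Ω p v = inner ℝ (valL Ω ybar - yd) (valL Ω v) - mu v) :
    objective Ω ν yd ud y u = objective Ω ν yd ud ybar ubar
      + 1 / 2 * ‖valL Ω (y - ybar)‖ ^ 2 + ν / 2 * ‖u - ubar‖ ^ 2
      + (mu (y - ybar) - (l2ToDual Ω q - l2ToDual Ω qbar) p) := by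
  have hy : ‖valL Ω y - yd‖ ^ 2 = ‖valL Ω ybar - yd‖ ^ 2
      + 2 * inner ℝ (valL Ω ybar - yd) (valL Ω (y - ybar)) + ‖valL Ω (y - ybar)‖ ^ 2 := by
    rw [← norm_add_sq_real, map_sub, sub_add_sub_cancel']
  have hU : ‖u - ud‖ ^ 2 = ‖ubar - ud‖ ^ 2 + 2 * inner ℝ (ubar - ud) (u - ubar)
      + ‖u - ubar‖ ^ 2 := by
    rw [← norm_add_sq_real, sub_add_sub_cancel']
  have hstate : aForm Ω p (y - ybar) + (l2ToDual Ω q - l2ToDual Ω qbar) p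
      = inner ℝ (u - ubar) (valL Ω p) := by
    have h := congrArg₂ (· - ·) (hu p) (hubar p)
    simp only [aForm, l2ToDual, map_sub, sub_apply, ContinuousLinearMap.comp_apply,
      innerSL_apply_apply, inner_sub_left, inner_sub_right,
      real_inner_comm (gradL Ω p)] at h ⊢
    linarith
  have hpu : inner ℝ (u - ubar) (valL Ω p) = -(ν * inner ℝ (ubar - ud) (u - ubar)) := by
    rw [eq_neg_of_add_eq_zero_left hgrad, inner_neg_right, real_inner_smul_right, real_inner_comm]
  rw [objective, objective, hy, hU]
  linarith [hadj (y - ybar)]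

end Objective

end EllipticVI

open EllipticVI in
theorem theorem5p3_general {d : ℕ} {Ω : Set (Euc d)} (hΩ_vol : volume Ω ≠ ⊤)
    (hΩ_slab : LiesInSlab Ω) {ν : ℝ} (hν : 0 < ν) {yd ud ubar : L2 Ω} {pbar : H01 Ω}
    {mubar : Hneg1 Ω} (hgrad : valL Ω pbar + ν • (ubar - ud) = 0)
    (hadj : ∀ v, aForm Ω pbar v
      = inner ℝ (valL Ω (solOp Ω (l2ToDual Ω ubar)) - yd) (valL Ω v) - mubar v)
    (hsign : ∃ ε > (0 : ℝ), ∀ u : L2 Ω, ‖u - ubar‖ ≤ ε →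
      0 ≤ mubar (solOp Ω (l2ToDual Ω u) - solOp Ω (l2ToDual Ω ubar))
        - (slackOp Ω (l2ToDual Ω u) - slackOp Ω (l2ToDual Ω ubar)) pbar) :
    QuadraticGrowth Ω ν yd ud ubar := by
  have : IsFiniteMeasure (volume.restrict Ω) := isFiniteMeasure_restrict.2 hΩ_vol
  obtain ⟨ε, hε, hsign⟩ := hsign
  refine ⟨ε, hε, ν / 2, half_pos hν, fun u hu => ?_⟩
  have hstate (u : L2 Ω) := (isSlack_slack hΩ_slab (l2ToDual Ω u)).1
  have hexpand := objective_eq_add_of_stationary (hstate u) (hstate ubar) hgrad hadj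
  have hsign_u := hsign u hu
  rw [slackOp, slackOp] at hsign_u
  rw [reducedObjective, reducedObjective, hexpand]
  linarith [sq_nonneg ‖valL Ω (solOp Ω (l2ToDual Ω u) - solOp Ω (l2ToDual Ω ubar))‖]

theorem theorem5p3 {d : ℕ} (hd : 1 ≤ d)
    (Ω : Set (EllipticVI.Euc d)) (hΩ_open : IsOpen Ω) (hΩ_conn : IsConnected Ω)
    (hΩ_bdd : Bornology.IsBounded Ω)
    (ν : ℝ) (hν : 0 < ν)
    (yd ud : EllipticVI.L2 Ω) (hud : MemLp ud ⊤ (volume.restrict Ω))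
    (ubar : EllipticVI.L2 Ω)
    -- the state `ybar = S(ubar)` and its slack variable
    (ybar : EllipticVI.H01 Ω)
    (hybar : ybar = EllipticVI.solOp Ω (EllipticVI.l2ToDual Ω ubar))
    (qbar : EllipticVI.L2 Ω)
    (hqbar : qbar = EllipticVI.slack Ω (EllipticVI.l2ToDual Ω ubar))
    -- regularity: `Y` is a `C¹(Ω)` representative of `ybar`
    (Y : EllipticVI.Euc d → ℝ)
    (hY_rep : EllipticVI.valL Ω ybar =ᵐ[volume.restrict Ω] Y) (hY_C1 : ContDiffOn ℝ 1 Y Ω)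
    -- structure of the active set
    (C : Set (EllipticVI.Euc d)) (hC : EllipticVI.ActiveSetStructure Ω Y C)
    (hM : EllipticVI.setM Ω Y = ∅)
    -- strong stationarity
    (pbar : EllipticVI.H01 Ω) (mubar : EllipticVI.Hneg1 Ω)
    (hstat : EllipticVI.StrongStationarity Ω ν yd ud ubar ybar Y C qbar pbar mubar)
    -- sign condition
    (hsign : ∃ ε > (0 : ℝ), ∀ u : EllipticVI.L2 Ω, ‖u - ubar‖ ≤ ε →
      0 ≤ mubar (EllipticVI.solOp Ω (EllipticVI.l2ToDual Ω u) - ybar)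
        - (EllipticVI.slackOp Ω (EllipticVI.l2ToDual Ω u) - EllipticVI.l2ToDual Ω qbar) pbar) :
    EllipticVI.QuadraticGrowth Ω ν yd ud ubar := by
  have : NeZero d := ⟨Nat.one_le_iff_ne_zero.1 hd⟩
  subst hybar hqbar
  exact theorem5p3_general hΩ_bdd.measure_lt_top.ne (.of_isBounded hΩ_bdd) hν hstat.gradient_eq
    (hstat.aForm_eq hM) hsign
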